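/- Let $\mathbf{K}$ be a commutative ring, let $u_0,u_1\in\mathbf{K}^\times$ and let $n\ge 0$. Let $B_{n+1}$ be the braid group on $n+1$ strands, presented by the Artin generators $\sigma_1,\dots,\sigma_n$ with relations $\sigma_i\sigma_{i+1}\sigma_i=\sigma_{i+1}\sigma_i\sigma_{i+1}$ and $\sigma_i\sigma_j=\sigma_j\sigma_i$ for $|i-j|\ge 2$. The Hecke algebra $H$ of type $A_n$ with parameters $u_0,u_1$ is the quotient of the group algebra $\mathbf{K}B_{n+1}$ by the relations $(\sigma-u_0)(\sigma-u_1)=0$ for every braided reflection $\sigma$, that is, for every conjugate $\sigma$ of an Artin generator. Let $$\Delta=(\sigma_1\sigma_2\cdots\sigma_n)(\sigma_1\cdots\sigma_{n-1})\cdots(\sigma_1\sigma_2)\,\sigma_1\in B_{n+1}$$ be Garside's fundamental element. Then the image of $\Delta$ in $H$ is annihilated by the polynomial $$\prod_{\substack{i,j\ge 0\\ i+j=n(n+1)}}\bigl(X^2-(-1)^i u_0^i u_1^j\bigr)\in\mathbf{K}[X].$$ -/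

import Mathlib

namespace TypeA

/-- Artin's relations on generators `σ_0, …, σ_{n-1}`:
`σ_i σ_{i+1} σ_i = σ_{i+1} σ_i σ_{i+1}`, and `σ_i σ_j = σ_j σ_i` when `|i - j| ≥ 2`. -/
def artinRelations (n : ℕ) : Set (FreeGroup (Fin n)) :=
  {r | ∃ i j : Fin n, i.val + 1 = j.val ∧
      r = FreeGroup.of i * FreeGroup.of j * FreeGroup.of i *
        (FreeGroup.of j * FreeGroup.of i * FreeGroup.of j)⁻¹} ∪
  {r | ∃ i j : Fin n, i.val + 1 < j.val ∧
      r = FreeGroup.of i * FreeGroup.of j * (FreeGroup.of j * FreeGroup.of i)⁻¹}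

/-- The braid group of type `A_n`, that is, the braid group on `n + 1` strands. -/
abbrev BraidGroup (n : ℕ) : Type := PresentedGroup (artinRelations n)

/-- The Artin generator `σ_i` of the braid group on `n + 1` strands. -/
def artinGen {n : ℕ} (i : Fin n) : BraidGroup n := PresentedGroup.of i

/-- The braided reflections in type `A_n` are the conjugates of the Artin generators. -/
def IsBraidedReflection {n : ℕ} (b : BraidGroup n) : Prop :=
  ∃ i : Fin n, IsConj (artinGen i) b

/-- The product `σ_0 σ_1 ⋯ σ_t`. -/
def initialProduct {n : ℕ} (t : Fin n) : BraidGroup n :=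
  (List.ofFn fun s : Fin (t.val + 1) => artinGen (Fin.castLE t.isLt s)).prod

/-- Garside's fundamental element
`Δ = (σ_0 σ_1 ⋯ σ_{n-1}) (σ_0 σ_1 ⋯ σ_{n-2}) ⋯ (σ_0 σ_1) σ_0` of the braid group on `n + 1`
strands. -/
def garside (n : ℕ) : BraidGroup n :=
  (List.ofFn fun t : Fin n => initialProduct t.rev).prod

/-- The Hecke relations `(σ - u₀) (σ - u₁) = 0` in the group algebra of the braid group, one for
every braided reflection `σ`. -/
inductive HeckeRel {K : Type*} [CommRing K] (n : ℕ) (u₀ u₁ : Kˣ) :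
    MonoidAlgebra K (BraidGroup n) → MonoidAlgebra K (BraidGroup n) → Prop
  | quadratic (b : BraidGroup n) (hb : IsBraidedReflection b) :
      HeckeRel n u₀ u₁
        ((MonoidAlgebra.of K (BraidGroup n) b - algebraMap K _ (u₀ : K)) *
          (MonoidAlgebra.of K (BraidGroup n) b - algebraMap K _ (u₁ : K))) 0

/-- The Hecke algebra of type `A_n` over `K` with parameters `u₀, u₁`: the quotient of the group
algebra of the braid group by the Hecke relations. -/
abbrev HeckeAlgebra {K : Type*} [CommRing K] (n : ℕ) (u₀ u₁ : Kˣ) : Type _ :=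
  RingQuot (HeckeRel n u₀ u₁)

/-- The natural map from the braid group to the Hecke algebra. -/
noncomputable def toHecke {K : Type*} [CommRing K] {n : ℕ} (u₀ u₁ : Kˣ) (b : BraidGroup n) :
    HeckeAlgebra n u₀ u₁ :=
  RingQuot.mkAlgHom K (HeckeRel n u₀ u₁) (MonoidAlgebra.of K (BraidGroup n) b)

end TypeA

/-!
Over a ring where `-u₀u₁` is a unit square, the Hecke algebra acts on the free module on the
permutations by symmetric matrices. For real `u₀`, `u₁` of opposite signs these make the
Jucys–Murphy elements `L k = s (k - 1) ⋯ s 0 s 0 ⋯ s (k - 1)` simultaneously diagonalizable. Passing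
from a joint eigenvector of `L 0, …, L (k + 1)` to another one by the intertwiner attached to `s k`
shows by induction that the eigenvalues of `L k` are of the form `u₀ ^ a (-u₁) ^ b` with
`a + b = 2k`. Since `Δ ^ 2 = L 1 ⋯ L n`, the identity holds for these parameters.

To reach arbitrary parameters, compare the given algebra with the permutation model inside their
product. The subalgebra generated by the pairs of generators is spanned by `(n + 1)!` elements and
maps onto the free module of rank `(n + 1)!` on the permutations, hence embeds in it, so every
polynomial identity satisfied by `Δ` in the model holds in the given algebra. In the model the
identity is one between matrices with entries in `ℤ[u₀, u₁]`, which may be checked at real points.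
-/

namespace TypeA

/-- A sequence in a monoid whose first `n` terms satisfy Artin's relations. Indexing by `ℕ` lets the
words below be defined by recursion; the terms from `s n` on are irrelevant. -/
structure IsBraidSystem {G : Type*} [Monoid G] (s : ℕ → G) (n : ℕ) : Prop where
  braid : ∀ i, i + 1 < n → s i * s (i + 1) * s i = s (i + 1) * s i * s (i + 1)
  comm : ∀ i j, i + 2 ≤ j → j < n → Commute (s i) (s j)

/-- The ascending product `s 0 * s 1 * ⋯ * s (k - 1)`. -/
def ascProd {G : Type*} [Monoid G] (s : ℕ → G) : ℕ → G
  | 0 => 1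
  | k + 1 => ascProd s k * s k

/-- The descending product `s (j + m - 1) * ⋯ * s (j + 1) * s j`. -/
def descProd {G : Type*} [Monoid G] (s : ℕ → G) (j : ℕ) : ℕ → G
  | 0 => 1
  | m + 1 => s (j + m) * descProd s j m

/-- Garside's fundamental element built from the first `k` terms of `s`. -/
def fundamental {G : Type*} [Monoid G] (s : ℕ → G) : ℕ → G
  | 0 => 1
  | k + 1 => ascProd s (k + 1) * fundamental s k

/-- The multiplicative Jucys–Murphy elements `s (k - 1) * ⋯ * s 0 * s 0 * ⋯ * s (k - 1)`. -/
def jucysMurphy {G : Type*} [Monoid G] (s : ℕ → G) : ℕ → G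
  | 0 => 1
  | k + 1 => s k * jucysMurphy s k * s k

section Map

variable {G H F : Type*} [Monoid G] [Monoid H] [FunLike F G H] [MonoidHomClass F G H]

theorem map_ascProd (f : F) (s : ℕ → G) (k : ℕ) :
    f (ascProd s k) = ascProd (fun i => f (s i)) k := by
  induction k with
  | zero => simp [ascProd]
  | succ k ih => simp [ascProd, ih]

theorem map_fundamental (f : F) (s : ℕ → G) (k : ℕ) :
    f (fundamental s k) = fundamental (fun i => f (s i)) k := by
  induction k with
  | zero => simp [fundamental]
  | succ k ih => simp [fundamental, ih, map_ascProd]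

theorem fundamental_prodMk (s : ℕ → G) (t : ℕ → H) (k : ℕ) :
    fundamental (fun i => (s i, t i)) k = (fundamental s k, fundamental t k) :=
  Prod.ext (map_fundamental (MonoidHom.fst G H) _ k) (map_fundamental (MonoidHom.snd G H) _ k)

theorem IsBraidSystem.map (f : F) {s : ℕ → G} {n : ℕ} (h : IsBraidSystem s n) :
    IsBraidSystem (fun i => f (s i)) n where
  braid i hi := by simp only [← map_mul, h.braid i hi]
  comm i j hij hj := (h.comm i j hij hj).map f

end Map

section Monoid

variable {G : Type*} [Monoid G] {s : ℕ → G} {n : ℕ}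

section Membership

variable {S : Submonoid G} {k : ℕ}

theorem ascProd_mem (h : ∀ i < k, s i ∈ S) : ascProd s k ∈ S := by
  induction k with
  | zero => exact S.one_mem
  | succ k ih => exact S.mul_mem (ih fun i hi => h i (by lia)) (h k (by lia))

theorem descProd_mem {j m : ℕ} (h : ∀ i, j ≤ i → i < j + m → s i ∈ S) : descProd s j m ∈ S := by
  induction m with
  | zero => exact S.one_mem
  | succ m ih =>
    exact S.mul_mem (h (j + m) (by lia) (by lia)) (ih fun i hi hi' => h i hi (by lia))

theorem fundamental_mem (h : ∀ i < k, s i ∈ S) : fundamental s k ∈ S := by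
  induction k with
  | zero => exact S.one_mem
  | succ k ih => exact S.mul_mem (ascProd_mem h) (ih fun i hi => h i (by lia))

theorem jucysMurphy_mem (h : ∀ i < k, s i ∈ S) : jucysMurphy s k ∈ S := by
  induction k with
  | zero => exact S.one_mem
  | succ k ih =>
    have hk := h k (by lia)
    exact S.mul_mem (S.mul_mem hk (ih fun i hi => h i (by lia))) hk

theorem mem_centralizer_singleton_iff {x y : G} :
    y ∈ Submonoid.centralizer {x} ↔ Commute x y := by
  simp [Submonoid.mem_centralizer_iff, Commute, SemiconjBy]

theorem commute_descProd {x : G} {j m : ℕ} (h : ∀ i, j ≤ i → i < j + m → Commute x (s i)) :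
    Commute x (descProd s j m) :=
  mem_centralizer_singleton_iff.1
    (descProd_mem fun i hi hi' => mem_centralizer_singleton_iff.2 (h i hi hi'))

theorem commute_fundamental {x : G} (h : ∀ i < k, Commute x (s i)) :
    Commute x (fundamental s k) :=
  mem_centralizer_singleton_iff.1
    (fundamental_mem fun i hi => mem_centralizer_singleton_iff.2 (h i hi))

theorem commute_jucysMurphy {x : G} (h : ∀ i < k, Commute x (s i)) :
    Commute x (jucysMurphy s k) :=
  mem_centralizer_singleton_iff.1
    (jucysMurphy_mem fun i hi => mem_centralizer_singleton_iff.2 (h i hi))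

end Membership

theorem ascProd_eq_prod_ofFn (s : ℕ → G) (k : ℕ) :
    ascProd s k = (List.ofFn fun i : Fin k => s i).prod := by
  induction k with
  | zero => simp [ascProd]
  | succ k ih =>
    rw [ascProd, ih, List.ofFn_succ', List.concat_eq_append, List.prod_append]
    simp

theorem fundamental_eq_prod_ofFn (s : ℕ → G) (k : ℕ) :
    fundamental s k = (List.ofFn fun i : Fin k => ascProd s (k - i)).prod := by
  induction k with
  | zero => simp [fundamental]
  | succ k ih => simp [fundamental, ih, List.ofFn_succ]

theorem descProd_succ_mul (s : ℕ → G) (j m : ℕ) :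
    descProd s (j + 1) m * s j = descProd s j (m + 1) := by
  induction m with
  | zero => simp [descProd]
  | succ m ih => rw [descProd, mul_assoc, ih, descProd.eq_2 s j (m + 1), add_right_comm, add_assoc]

theorem descProd_mul_ascProd (s : ℕ → G) (k : ℕ) :
    descProd s 0 k * ascProd s k = jucysMurphy s k := by
  induction k with
  | zero => simp [descProd, ascProd, jucysMurphy]
  | succ k ih => simp only [descProd, ascProd, jucysMurphy, ← ih, zero_add, mul_assoc]

theorem commute_conj_of_braid {r t x : G} (hrt : r * t * r = t * r * t) (htx : Commute t x) :
    Commute r (t * (r * x * r) * t) := by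
  calc r * (t * (r * x * r) * t)
      = r * t * r * x * r * t := by simp only [mul_assoc]
    _ = t * r * (t * x) * r * t := by rw [hrt]; simp only [mul_assoc]
    _ = t * r * x * (t * r * t) := by rw [htx.eq]; simp only [mul_assoc]
    _ = t * (r * x * r) * t * r := by rw [← hrt]; simp only [mul_assoc]

namespace IsBraidSystem

theorem commute_jucysMurphy_of_lt (h : IsBraidSystem s n) {k j : ℕ} (hkj : k < j) (hj : j < n) :
    Commute (s j) (jucysMurphy s k) :=
  commute_jucysMurphy fun i hi => (h.comm i j (by lia) hj).symm

theorem commute_jucysMurphy_of_gt (h : IsBraidSystem s n) {j k : ℕ} (hjk : j + 1 < k)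
    (hk : k ≤ n) : Commute (s j) (jucysMurphy s k) := by
  induction k with
  | zero => lia
  | succ k ih =>
    rcases Nat.lt_or_ge (j + 1) k with hjk | hjk
    · have hc := h.comm j k hjk hk
      exact (hc.mul_right (ih hjk (by lia))).mul_right hc
    · obtain rfl : k = j + 1 := by lia
      exact commute_conj_of_braid (h.braid j hk) (h.commute_jucysMurphy_of_lt j.lt_succ_self hk)

theorem commute_jucysMurphy_jucysMurphy (h : IsBraidSystem s n) {j k : ℕ} (hj : j ≤ n)
    (hk : k ≤ n) : Commute (jucysMurphy s j) (jucysMurphy s k) := by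
  wlog hjk : j ≤ k generalizing j k
  · exact (this hk hj (by lia)).symm
  rcases hjk.eq_or_lt with rfl | hjk
  · exact Commute.refl _
  · exact (commute_jucysMurphy fun i hi =>
      (h.commute_jucysMurphy_of_gt (by lia) hk).symm).symm

theorem fundamental_succ_eq_mul_descProd (h : IsBraidSystem s n) {k : ℕ} (hk : k < n) :
    fundamental s (k + 1) = fundamental s k * descProd s 0 (k + 1) := by
  induction k with
  | zero => simp [fundamental, ascProd, descProd]
  | succ k ih =>
    have hc : Commute (s (k + 1)) (fundamental s k) :=
      commute_fundamental fun i hi => (h.comm i (k + 1) (by lia) hk).symm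
    calc fundamental s (k + 2)
        = ascProd s (k + 1) * s (k + 1) * fundamental s (k + 1) := rfl
      _ = ascProd s (k + 1) * (s (k + 1) * fundamental s k) * descProd s 0 (k + 1) := by
        rw [ih (by lia)]; simp only [mul_assoc]
      _ = fundamental s (k + 1) * (s (0 + (k + 1)) * descProd s 0 (k + 1)) := by
        rw [hc.eq, fundamental, zero_add]; simp only [mul_assoc]

theorem fundamental_succ_sq (h : IsBraidSystem s n) {k : ℕ} (hk : k < n) :
    fundamental s (k + 1) ^ 2 = fundamental s k ^ 2 * jucysMurphy s (k + 1) := by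
  have hc : Commute (jucysMurphy s (k + 1)) (fundamental s k) :=
    commute_fundamental fun i hi => (h.commute_jucysMurphy_of_gt (by lia) hk).symm
  calc fundamental s (k + 1) ^ 2
      = fundamental s k * (descProd s 0 (k + 1) * ascProd s (k + 1)) * fundamental s k := by
        rw [pow_two]
        nth_rewrite 1 [h.fundamental_succ_eq_mul_descProd hk]
        rw [fundamental]
        simp only [mul_assoc]
    _ = fundamental s k ^ 2 * jucysMurphy s (k + 1) := by
        rw [descProd_mul_ascProd, mul_assoc, hc.eq, pow_two, mul_assoc]

theorem descProd_mul_succ (h : IsBraidSystem s n) {i j m : ℕ} (hji : j ≤ i)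
    (him : i + 1 < j + m) (hm : j + m ≤ n) :
    descProd s j m * s (i + 1) = s i * descProd s j m := by
  induction m with
  | zero => lia
  | succ m ih =>
    rcases Nat.lt_or_ge (i + 1) (j + m) with hlt | hge
    · rw [descProd, mul_assoc, ih hlt (by lia), ← mul_assoc, ← mul_assoc,
        (h.comm i (j + m) hlt hm).eq]
    · obtain ⟨m, rfl⟩ : ∃ m', m = m' + 1 := ⟨m - 1, by lia⟩
      obtain rfl : i = j + m := by lia
      have hc : Commute (s (j + m + 1)) (descProd s j m) :=
        commute_descProd fun l _ hl => (h.comm l _ (by lia) (by lia)).symm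
      calc s (j + m + 1) * (s (j + m) * descProd s j m) * s (j + m + 1)
          = s (j + m + 1) * s (j + m) * (descProd s j m * s (j + m + 1)) := by
            simp only [mul_assoc]
        _ = s (j + m + 1) * s (j + m) * s (j + m + 1) * descProd s j m := by
            rw [← hc.eq]; simp only [mul_assoc]
        _ = s (j + m) * (s (j + m + 1) * (s (j + m) * descProd s j m)) := by
            rw [← h.braid _ (by lia)]; simp only [mul_assoc]

end IsBraidSystem

end Monoid

section Algebra

variable {K A : Type*} [CommRing K] [Ring A] [Algebra K A]

theorem sub_algebraMap_mul_sub_algebraMap_eq_zero_iff {x : A} {u v : K} :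
    (x - algebraMap K A u) * (x - algebraMap K A v) = 0 ↔ x * x = (u + v) • x - (u * v) • 1 := by
  have hexpand : (x - algebraMap K A u) * (x - algebraMap K A v) =
      x * x - ((u + v) • x - (u * v) • 1) := by
    simp only [Algebra.algebraMap_eq_smul_one, sub_mul, mul_sub, smul_mul_assoc, mul_smul_comm,
      one_mul, mul_one]
    module
  rw [hexpand, sub_eq_zero]

/-- A braid system in a `K`-algebra all of whose members satisfy the Hecke relation with parameters
`u₀, u₁`. -/
structure IsHeckeSystem (u₀ u₁ : K) (s : ℕ → A) (n : ℕ) : Prop extends IsBraidSystem s n where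
  quadratic : ∀ i < n, (s i - algebraMap K A u₀) * (s i - algebraMap K A u₁) = 0

namespace IsHeckeSystem

variable {B : Type*} [Ring B] [Algebra K B] {u₀ u₁ : K} {s : ℕ → A} {n : ℕ}

theorem mul_self (h : IsHeckeSystem u₀ u₁ s n) {i : ℕ} (hi : i < n) :
    s i * s i = (u₀ + u₁) • s i - (u₀ * u₁) • 1 :=
  sub_algebraMap_mul_sub_algebraMap_eq_zero_iff.1 (h.quadratic i hi)

theorem map (f : A →ₐ[K] B) (h : IsHeckeSystem u₀ u₁ s n) :
    IsHeckeSystem u₀ u₁ (fun i => f (s i)) n where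
  toIsBraidSystem := h.toIsBraidSystem.map f
  quadratic i hi := by simpa using congrArg f (h.quadratic i hi)

theorem prod {t : ℕ → B} (hs : IsHeckeSystem u₀ u₁ s n) (ht : IsHeckeSystem u₀ u₁ t n) :
    IsHeckeSystem u₀ u₁ (fun i => (s i, t i)) n where
  braid i hi := Prod.ext (hs.braid i hi) (ht.braid i hi)
  comm i j hij hj := (hs.comm i j hij hj).prod (ht.comm i j hij hj)
  quadratic i hi := Prod.ext (hs.quadratic i hi) (ht.quadratic i hi)

end IsHeckeSystem

theorem toSubmodule_adjoin_le {X : Set A} {N : Submodule K A} (hone : 1 ∈ N)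
    (hmul : ∀ x ∈ N, ∀ y ∈ X, x * y ∈ N) : (Algebra.adjoin K X).toSubmodule ≤ N := by
  rw [Algebra.adjoin_eq_span, Submodule.span_le]
  intro x hx
  induction hx using Submonoid.closure_induction_right with
  | one => exact hone
  | mul_right x _ y hy ih => exact hmul x ih y hy

end Algebra

section Span

open scoped Pointwise Nat

variable {K A : Type*} [CommRing K] [Ring A] [Algebra K A] {u₀ u₁ : K} {s : ℕ → A} {n : ℕ}

open scoped Classical in
/-- The elements `s k * ⋯ * s j` for `j ≤ k + 1`, the shortest representatives of the right cosets
of the symmetric group on `k + 1` letters in the one on `k + 2` letters. -/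
noncomputable def cosetReps (s : ℕ → A) (k : ℕ) : Finset A :=
  (Finset.HasAntidiagonal.antidiagonal (k + 1)).image fun p => descProd s p.1 p.2

theorem card_cosetReps_le (s : ℕ → A) (k : ℕ) : (cosetReps s k).card ≤ k + 2 := by
  classical exact Finset.card_image_le.trans (by simp)

theorem descProd_mem_cosetReps {j m k : ℕ} (hjm : j + m = k + 1) :
    descProd s j m ∈ cosetReps s k := by
  classical exact Finset.mem_image.2 ⟨(j, m), by simpa, rfl⟩

/-- The product of the subalgebra generated by the first `k` terms of `s` with the span of
`cosetReps s k`; for a Hecke system it contains the subalgebra generated by one more term. -/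
noncomputable def cosetSpan (K : Type*) [CommRing K] [Algebra K A] (s : ℕ → A) (k : ℕ) :
    Submodule K A :=
  (Algebra.adjoin K (s '' Set.Iio k)).toSubmodule * Submodule.span K (cosetReps s k : Set A)

theorem mul_descProd_mem_cosetSpan {x : A} {j m k : ℕ}
    (hx : x ∈ Algebra.adjoin K (s '' Set.Iio k)) (hjm : j + m = k + 1) :
    x * descProd s j m ∈ cosetSpan K s k :=
  Submodule.mul_mem_mul hx (Submodule.subset_span (descProd_mem_cosetReps hjm))

theorem descProd_mem_cosetSpan {j m k : ℕ} (hjm : j + m = k + 1) :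
    descProd s j m ∈ cosetSpan K s k := by
  simpa using mul_descProd_mem_cosetSpan (K := K) (s := s) (one_mem _) hjm

namespace IsHeckeSystem

theorem descProd_mul_mem_cosetSpan (h : IsHeckeSystem u₀ u₁ s n) {i j m k : ℕ} (hi : i ≤ k)
    (hk : k < n) (hjm : j + m = k + 1) : descProd s j m * s i ∈ cosetSpan K s k := by
  have hgen : ∀ {l}, l < k → s l ∈ Algebra.adjoin K (s '' Set.Iio k) := fun hl =>
    Algebra.subset_adjoin ⟨_, hl, rfl⟩
  rcases lt_trichotomy (i + 1) j with hij | rfl | hij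
  · have hc : Commute (s i) (descProd s j m) :=
      commute_descProd fun l hl hl' => h.comm i l (by lia) (by lia)
    rw [← hc.eq]
    exact mul_descProd_mem_cosetSpan (hgen (by lia)) hjm
  · rw [descProd_succ_mul]
    exact descProd_mem_cosetSpan (by lia)
  · rcases (Nat.le_of_lt_succ hij).eq_or_lt with rfl | hij
    · obtain ⟨m, rfl⟩ : ∃ m', m = m' + 1 := ⟨m - 1, by lia⟩
      rw [← descProd_succ_mul, mul_assoc, h.mul_self (by lia), mul_sub, mul_smul_comm,
        mul_smul_comm, mul_one, descProd_succ_mul]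
      exact sub_mem (Submodule.smul_mem _ _ (descProd_mem_cosetSpan hjm))
        (Submodule.smul_mem _ _ (descProd_mem_cosetSpan (by lia)))
    · obtain ⟨i, rfl⟩ : ∃ i', i = i' + 1 := ⟨i - 1, by lia⟩
      rw [h.descProd_mul_succ (by lia) (by lia) (by lia)]
      exact mul_descProd_mem_cosetSpan (hgen hi) hjm

theorem adjoin_succ_le_cosetSpan (h : IsHeckeSystem u₀ u₁ s n) {k : ℕ} (hk : k < n) :
    (Algebra.adjoin K (s '' Set.Iio (k + 1))).toSubmodule ≤ cosetSpan K s k := by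
  refine toSubmodule_adjoin_le (descProd_mem_cosetSpan (m := 0) (add_zero _)) ?_
  rintro x hx _ ⟨i, hi, rfl⟩
  have hreps : ∀ d ∈ Submodule.span K (cosetReps s k : Set A), d * s i ∈ cosetSpan K s k := by
    intro d hd
    refine Submodule.span_le (p := (cosetSpan K s k).comap (LinearMap.mulRight K (s i))).2 ?_ hd
    intro d hd
    classical
    obtain ⟨⟨j, m⟩, hjm, rfl⟩ := Finset.mem_image.1 hd
    exact h.descProd_mul_mem_cosetSpan (Nat.le_of_lt_succ hi) hk
      (Finset.HasAntidiagonal.mem_antidiagonal.1 hjm)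
  refine Submodule.mul_induction_on hx (fun a ha d hd => ?_) fun x y hx hy => ?_
  · rw [mul_assoc]
    have hmem := Submodule.mul_mem_mul ha (hreps d hd)
    rwa [cosetSpan, ← mul_assoc, Subalgebra.isIdempotentElem_toSubmodule] at hmem
  · rw [add_mul]
    exact add_mem hx hy

theorem exists_card_le_factorial_adjoin_le_span (h : IsHeckeSystem u₀ u₁ s n) {k : ℕ}
    (hk : k ≤ n) : ∃ B : Finset A, B.card ≤ (k + 1)! ∧
      (Algebra.adjoin K (s '' Set.Iio k)).toSubmodule ≤ Submodule.span K (B : Set A) := by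
  classical
  induction k with
  | zero =>
    refine ⟨{1}, by simp, toSubmodule_adjoin_le (Submodule.subset_span (by simp)) (by simp)⟩
  | succ k ih =>
    obtain ⟨B, hB, hspan⟩ := ih (by lia)
    refine ⟨B * cosetReps s k, ?_, (h.adjoin_succ_le_cosetSpan hk).trans ?_⟩
    · calc (B * cosetReps s k).card
          ≤ B.card * (cosetReps s k).card := Finset.card_mul_le
        _ ≤ (k + 1)! * (k + 2) := Nat.mul_le_mul hB (card_cosetReps_le s k)
        _ = (k + 2)! := by rw [Nat.factorial_succ (k + 1), mul_comm]
    · rw [Finset.coe_mul, ← Submodule.span_mul_span]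
      exact mul_le_mul' hspan le_rfl

end IsHeckeSystem

theorem injOn_span_of_card_le {ι M : Type*} [Fintype ι] [AddCommGroup M] [Module K M]
    {B : Finset M} (hB : B.card ≤ Fintype.card ι) (f : M →ₗ[K] ι → K)
    (hf : (Submodule.span K (B : Set M)).map f = ⊤) :
    Set.InjOn f (Submodule.span K (B : Set M)) := by
  obtain ⟨e⟩ := Function.Embedding.nonempty_of_card_le (α := B) (β := ι) (by simpa using hB)
  let g := Fintype.linearCombination K (Subtype.val : B → M)
  have hg : LinearMap.range g = Submodule.span K (B : Set M) := by
    rw [Fintype.range_linearCombination, Subtype.range_coe]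
  have hfg : Function.Surjective (f ∘ₗ g) := by
    rw [← LinearMap.range_eq_top, LinearMap.range_comp, hg, hf]
  have hinj := OrzechProperty.injective_of_surjective_of_injective
    (Function.ExtendByZero.linearMap K e) (f ∘ₗ g)
    (Function.extend_injective e.injective (0 : ι → K)) hfg
  rw [← hg]
  rintro _ ⟨x, rfl⟩ _ ⟨y, rfl⟩ hxy
  exact congrArg g (hinj hxy)

end Span

section Eigenvalue

variable {F V : Type*} [Field F] [AddCommGroup V] [Module F V] {u₀ u₁ : F}

section Intertwiner

variable {T X : Module.End F V}

theorem apply_apply_eq_smul_of_apply_apply_apply_eq (h₀ : u₀ ≠ 0) (h₁ : u₁ ≠ 0)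
    (hT : ∀ x, T (T x) = (u₀ + u₁) • T x - (u₀ * u₁) • x) {β : F} {v : V}
    (hv : T (X (T v)) = (-(u₀ * u₁) * β) • v) :
    X (T v) = β • (T v - (u₀ + u₁) • v) := by
  have hTT := hT (X (T v))
  rw [hv, map_smul] at hTT
  refine smul_right_injective V (mul_ne_zero h₀ h₁) ?_
  calc (u₀ * u₁) • X (T v)
      = (u₀ + u₁) • (-(u₀ * u₁) * β) • v - (-(u₀ * u₁) * β) • T v := by rw [hTT]; abel
    _ = (u₀ * u₁) • β • (T v - (u₀ + u₁) • v) := by module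

theorem eq_or_eq_of_apply_eq_smul (hT : ∀ x, T (T x) = (u₀ + u₁) • T x - (u₀ * u₁) • x)
    {γ : F} {v : V} (hv : v ≠ 0) (hγ : T v = γ • v) : γ = u₀ ∨ γ = u₁ := by
  have hroot : ((γ - u₀) * (γ - u₁)) • v = 0 := by
    have hTT := hT v
    simp only [hγ, map_smul] at hTT
    rw [← sub_eq_zero] at hTT
    rw [← hTT]
    module
  simpa only [smul_eq_zero, hv, or_false, mul_eq_zero, sub_eq_zero] using hroot

theorem eq_or_eq_or_exists_eigenvector (h₀ : u₀ ≠ 0) (h₁ : u₁ ≠ 0)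
    (hT : ∀ x, T (T x) = (u₀ + u₁) • T x - (u₀ * u₁) • x) {a c : F} {v : V} (hv : v ≠ 0)
    (hX : X v = a • v) (hTXT : T (X (T v)) = c • v) :
    c = u₀ ^ 2 * a ∨ c = u₁ ^ 2 * a ∨ ∃ β p q : F, c = -(u₀ * u₁) * β ∧
      p • T v + q • v ≠ 0 ∧ X (p • T v + q • v) = β • (p • T v + q • v) := by
  obtain ⟨β, rfl⟩ : ∃ β, c = -(u₀ * u₁) * β := ⟨c / -(u₀ * u₁), by field_simp⟩
  by_cases hβ : β = a
  · exact .inr (.inr ⟨β, 0, 1, rfl, by simpa, by simp [hX, hβ]⟩)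
  have hXT := apply_apply_eq_smul_of_apply_apply_apply_eq h₀ h₁ hT hTXT
  by_cases hw : (a - β) • T v + (β * (u₀ + u₁)) • v = 0
  · have hsub : a - β ≠ 0 := sub_ne_zero.2 (Ne.symm hβ)
    obtain ⟨γ, hγ⟩ : ∃ γ, T v = γ • v := by
      refine ⟨-(β * (u₀ + u₁)) / (a - β), smul_right_injective V hsub ?_⟩
      simp only [smul_smul, mul_div_cancel₀ _ hsub, neg_smul, eq_neg_of_add_eq_zero_left hw]
    have hc : -(u₀ * u₁) * β = γ ^ 2 * a := by
      simp only [hγ, map_smul, hX, smul_smul] at hTXT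
      linear_combination -smul_left_injective F hv hTXT
    rcases eq_or_eq_of_apply_eq_smul hT hv hγ with rfl | rfl
    · exact .inl hc
    · exact .inr (.inl hc)
  · refine .inr (.inr ⟨β, a - β, β * (u₀ + u₁), rfl, hw, ?_⟩)
    rw [map_add, map_smul, map_smul, hXT, hX]
    module

end Intertwiner

namespace IsHeckeSystem

variable {s : ℕ → Module.End F V} {n : ℕ}

theorem exists_jucysMurphy_eigenvalue (h : IsHeckeSystem u₀ u₁ s n) (h₀ : u₀ ≠ 0) (h₁ : u₁ ≠ 0)
    {k : ℕ} (hk : k ≤ n) {χ : ℕ → F} {v : V} (hv : v ≠ 0)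
    (hχ : ∀ j ≤ k, jucysMurphy s j v = χ j • v) :
    ∃ a b, a + b = 2 * k ∧ χ k = u₀ ^ a * (-u₁) ^ b := by
  induction k generalizing χ v with
  | zero =>
    have hone : (1 : F) • v = χ 0 • v := (one_smul F v).trans (hχ 0 le_rfl)
    exact ⟨0, 0, rfl, by simpa using (smul_left_injective F hv hone).symm⟩
  | succ k ih =>
    have hT : ∀ x, s k (s k x) = (u₀ + u₁) • s k x - (u₀ * u₁) • x := fun x => by
      simpa using LinearMap.congr_fun (h.mul_self hk) x
    obtain ⟨a, b, hab, hχk⟩ := ih (by lia) hv fun j hj => hχ j (by lia)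
    rcases eq_or_eq_or_exists_eigenvector h₀ h₁ hT hv (hχ k (by lia)) (hχ (k + 1) le_rfl) with
      hc | hc | ⟨β, p, q, hc, hw, hβ⟩
    · exact ⟨a + 2, b, by lia, by rw [hc, hχk]; ring⟩
    · exact ⟨a, b + 2, by lia, by rw [hc, hχk]; ring⟩
    · have hχ' : ∀ j ≤ k, jucysMurphy s j (p • s k v + q • v) =
          Function.update χ k β j • (p • s k v + q • v) := by
        intro j hj
        rcases hj.eq_or_lt with rfl | hj
        · rw [Function.update_self, hβ]
        · have hcomm : jucysMurphy s j (s k v) = s k (jucysMurphy s j v) :=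
            (LinearMap.congr_fun (h.commute_jucysMurphy_of_lt hj hk).eq v).symm
          rw [Function.update_of_ne hj.ne, map_add, map_smul, map_smul, hcomm, hχ j (by lia),
            map_smul]
          module
      obtain ⟨a', b', hab', hβ'⟩ := ih (by lia) hw hχ'
      rw [Function.update_self] at hβ'
      exact ⟨a' + 1, b' + 1, by lia, by rw [hc, hβ']; ring⟩

theorem exists_fundamental_sq_eigenvalue (h : IsHeckeSystem u₀ u₁ s n) (h₀ : u₀ ≠ 0)
    (h₁ : u₁ ≠ 0) {k : ℕ} (hk : k ≤ n) {χ : ℕ → F} {v : V} (hv : v ≠ 0)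
    (hχ : ∀ j ≤ k, jucysMurphy s j v = χ j • v) :
    ∃ a b, a + b = k * (k + 1) ∧ (fundamental s k ^ 2) v = (u₀ ^ a * (-u₁) ^ b) • v := by
  induction k with
  | zero => exact ⟨0, 0, rfl, by simp [fundamental]⟩
  | succ k ih =>
    obtain ⟨a, b, hab, hv'⟩ := ih (by lia) fun j hj => hχ j (by lia)
    obtain ⟨a', b', hab', hχ'⟩ := h.exists_jucysMurphy_eigenvalue h₀ h₁ hk hv hχ
    refine ⟨a + a', b + b', by lia, ?_⟩
    rw [h.fundamental_succ_sq hk, Module.End.mul_apply, hχ _ le_rfl, map_smul, hv', hχ',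
      smul_smul]
    congr 1
    ring

end IsHeckeSystem

end Eigenvalue

section Polynomial

open Polynomial

/-- The polynomial `∏ (X ^ 2 - (-1) ^ i u₀ ^ i u₁ ^ j)` over `i + j = n (n + 1)`, which annihilates
the fundamental element of a Hecke system. -/
noncomputable def garsidePoly {K : Type*} [CommRing K] (n : ℕ) (u₀ u₁ : K) : K[X] :=
  ∏ p ∈ Finset.HasAntidiagonal.antidiagonal (n * (n + 1)),
    (X ^ 2 - C ((-1 : K) ^ p.1 * u₀ ^ p.1 * u₁ ^ p.2))

theorem garsidePoly_map {K L : Type*} [CommRing K] [CommRing L] (φ : K →+* L) (n : ℕ)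
    (u₀ u₁ : K) : (garsidePoly n u₀ u₁).map φ = garsidePoly n (φ u₀) (φ u₁) := by
  simp [garsidePoly, Polynomial.map_prod]

theorem garsidePoly_eq_comp {K : Type*} [CommRing K] (n : ℕ) (u₀ u₁ : K) :
    garsidePoly n u₀ u₁ = (∏ p ∈ Finset.HasAntidiagonal.antidiagonal (n * (n + 1)),
      (X - C (u₀ ^ p.1 * (-u₁) ^ p.2))).comp (X ^ 2) := by
  rw [garsidePoly, prod_comp]
  refine Finset.prod_congr rfl fun p hp => ?_
  have hparity : (-1 : K) ^ p.1 = (-1) ^ p.2 := by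
    have heven := Nat.even_mul_succ_self n
    rw [← Finset.HasAntidiagonal.mem_antidiagonal.1 hp, Nat.even_add] at heven
    exact neg_one_pow_congr heven
  rw [hparity, neg_pow u₁, sub_comp, X_comp, C_comp, mul_assoc, mul_left_comm]

theorem IsHeckeSystem.aeval_fundamental_eq_zero_of_isSymmetric {𝕜 E : Type*} [RCLike 𝕜]
    [NormedAddCommGroup E] [InnerProductSpace 𝕜 E] [FiniteDimensional 𝕜 E] {u₀ u₁ : 𝕜}
    {s : ℕ → Module.End 𝕜 E} {n : ℕ} (h : IsHeckeSystem u₀ u₁ s n) (h₀ : u₀ ≠ 0) (h₁ : u₁ ≠ 0)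
    (hs : ∀ i < n, (s i).IsSymmetric) :
    aeval (fundamental s n) (garsidePoly n u₀ u₁) = 0 := by
  have hsymm : ∀ k ≤ n, (jucysMurphy s k).IsSymmetric := by
    intro k hk
    induction k with
    | zero => exact LinearMap.IsSymmetric.one
    | succ k ih =>
      intro x y
      simp only [jucysMurphy, Module.End.mul_apply, hs k hk _ _, ih (by lia) _ _]
  have htop := LinearMap.IsSymmetric.iSup_iInf_eq_top_of_commute
    (T := fun j : ℕ => jucysMurphy s (min j n)) (fun j => hsymm _ (min_le_right j n))
    fun i j _ => h.commute_jucysMurphy_jucysMurphy (min_le_right i n) (min_le_right j n)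
  rw [garsidePoly_eq_comp, aeval_comp, aeval_X_pow, ← LinearMap.ker_eq_top, eq_top_iff, ← htop,
    iSup_le_iff]
  intro χ v hv
  rw [LinearMap.mem_ker]
  rcases eq_or_ne v 0 with rfl | hv0
  · exact map_zero _
  have hχ : ∀ j ≤ n, jucysMurphy s j v = χ j • v := fun j hj => by
    simpa [hj] using (Submodule.mem_iInf _).1 hv j
  obtain ⟨a, b, hab, hev⟩ := h.exists_fundamental_sq_eigenvalue h₀ h₁ le_rfl hv0 hχ
  rw [Module.End.aeval_apply_of_hasEigenvector (Module.End.hasEigenvector_iff.2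
    ⟨Module.End.mem_eigenspace_iff.2 hev, hv0⟩), eval_prod,
    Finset.prod_eq_zero (i := (a, b)) (Finset.HasAntidiagonal.mem_antidiagonal.2 hab) (by simp),
    zero_smul]

end Polynomial

section Permutations

open Equiv (Perm swap)

theorem swap_mul_swap_mul_swap_comm {ι : Type*} [DecidableEq ι] {a b c : ι} (hab : a ≠ b)
    (hbc : b ≠ c) (hac : a ≠ c) :
    swap a b * swap b c * swap a b = swap b c * swap a b * swap b c := by
  rw [Equiv.swap_mul_swap_mul_swap hab hac, Equiv.swap_comm a b, Equiv.swap_comm b c,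
    Equiv.swap_mul_swap_mul_swap hbc.symm hac.symm, Equiv.swap_comm]

theorem perm_induction_of_ascent {n : ℕ} {P : Perm (Fin (n + 1)) → Prop} (one : P 1)
    (mul_swap : ∀ (w : Perm (Fin (n + 1))) (i : Fin n), w i.castSucc < w i.succ → P w →
      P (w * swap i.castSucc i.succ)) (w : Perm (Fin (n + 1))) : P w := by
  induction hw : toLex ⇑w using WellFoundedLT.induction generalizing w with
  | ind f ih =>
    subst hw
    by_cases hmono : Monotone w
    · rwa [(Equiv.Perm.monotone_iff w).1 hmono]
    · obtain ⟨i, hi⟩ : ∃ i : Fin n, w i.succ < w i.castSucc := by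
        simpa [Fin.monotone_iff_le_succ] using hmono
      have hlt : toLex ⇑(w * swap i.castSucc i.succ) < toLex ⇑w :=
        Pi.lex_desc i.castSucc_lt_succ.le hi
      simpa [mul_assoc] using mul_swap _ i (by simpa using hi) (ih _ hlt _ rfl)

end Permutations

section Model

open Equiv (Perm swap)
open Polynomial

section HeckeMatrix

variable {ι K : Type*} [Fintype ι] [LinearOrder ι] [CommRing K]

/-- The matrix by which a generator of the Hecke algebra acts on the free module on permutations:
the permutation `w` is sent to `α • (w * swap a b)` if `w a < w b`, and to
`t • w + β • (w * swap a b)` otherwise. -/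
def heckeMatrix (t α β : K) (a b : ι) : Matrix (Perm ι) (Perm ι) K :=
  Matrix.of fun v w => if w a < w b then (if v = w * swap a b then α else 0)
    else (if v = w then t else 0) + (if v = w * swap a b then β else 0)

theorem heckeMatrix_mulVec_single (t α β : K) (a b : ι) (w : Perm ι) :
    (heckeMatrix t α β a b).mulVec (Pi.single w 1) =
      if w a < w b then α • Pi.single (w * swap a b) 1
      else t • Pi.single w 1 + β • Pi.single (w * swap a b) 1 := by
  ext v
  rw [Matrix.mulVec_single_one]
  split_ifs with h <;> simp [heckeMatrix, h, Pi.single_apply]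

theorem heckeMatrix_map {L : Type*} [CommRing L] (φ : K →+* L) (t α β : K) (a b : ι) :
    φ.mapMatrix (heckeMatrix t α β a b) = heckeMatrix (φ t) (φ α) (φ β) a b := by
  ext v w
  simp only [RingHom.mapMatrix_apply, Matrix.map_apply, heckeMatrix, Matrix.of_apply]
  split_ifs <;> simp

theorem heckeMatrix_isSymm (t α : K) (a b : ι) : (heckeMatrix t α α a b).IsSymm := by
  ext v w
  have hswap : v = w * swap a b ↔ w = v * swap a b := by
    constructor <;> rintro rfl <;> simp [mul_assoc]
  simp only [Matrix.transpose_apply, heckeMatrix, Matrix.of_apply, ← hswap]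
  rcases eq_or_ne v w with rfl | h
  · rfl
  · simp [h, h.symm]

theorem heckeMatrix_mul_self (t α β : K) {a b : ι} (hab : a ≠ b) :
    heckeMatrix t α β a b * heckeMatrix t α β a b =
      t • heckeMatrix t α β a b + (α * β) • 1 := by
  refine Matrix.ext_of_mulVec_single fun w => ?_
  have hsq : w * swap a b * swap a b = w := by simp [mul_assoc]
  rw [Matrix.add_mulVec, Matrix.smul_mulVec, Matrix.smul_mulVec, Matrix.one_mulVec,
    ← Matrix.mulVec_mulVec]
  rcases lt_or_gt_of_ne (w.injective.ne hab) with h | h <;>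
  · simp only [heckeMatrix_mulVec_single, Matrix.mulVec_smul, Matrix.mulVec_add, h, h.not_gt, hsq,
      Equiv.Perm.mul_apply, Equiv.swap_apply_left, Equiv.swap_apply_right, if_true, if_false]
    module

theorem heckeMatrix_commute (t α β : K) {a b c d : ι} (hac : a ≠ c) (had : a ≠ d) (hbc : b ≠ c)
    (hbd : b ≠ d) : Commute (heckeMatrix t α β a b) (heckeMatrix t α β c d) := by
  refine Matrix.ext_of_mulVec_single fun w => ?_
  have hcda : swap c d a = a := Equiv.swap_apply_of_ne_of_ne hac had
  have hcdb : swap c d b = b := Equiv.swap_apply_of_ne_of_ne hbc hbd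
  have habc : swap a b c = c := Equiv.swap_apply_of_ne_of_ne hac.symm hbc.symm
  have habd : swap a b d = d := Equiv.swap_apply_of_ne_of_ne had.symm hbd.symm
  have hswap : w * swap a b * swap c d = w * swap c d * swap a b := by
    have hconj := Equiv.mul_swap_eq_swap_mul (swap a b) c d
    rw [habc, habd] at hconj
    rw [mul_assoc, mul_assoc, hconj]
  simp only [← Matrix.mulVec_mulVec]
  by_cases h : w a < w b <;> by_cases h' : w c < w d <;>
  · simp only [heckeMatrix_mulVec_single, Matrix.mulVec_smul, Matrix.mulVec_add, h, h', hcda, hcdb,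
      habc, habd, hswap, Equiv.Perm.mul_apply, if_true, if_false] <;> module

theorem heckeMatrix_braid (t α β : K) {a b c : ι} (hab : a ≠ b) (hbc : b ≠ c) (hac : a ≠ c) :
    heckeMatrix t α β a b * heckeMatrix t α β b c * heckeMatrix t α β a b =
      heckeMatrix t α β b c * heckeMatrix t α β a b * heckeMatrix t α β b c := by
  refine Matrix.ext_of_mulVec_single fun w => ?_
  have hswap : w * swap a b * swap b c * swap a b = w * swap b c * swap a b * swap b c := by
    simpa only [mul_assoc] using congrArg (w * ·) (swap_mul_swap_mul_swap_comm hab hbc hac)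
  have hsq : ∀ (v : Perm ι) (x y : ι), v * swap x y * swap x y = v := fun v x y => by
    simp [mul_assoc]
  have habc : swap a b c = c := Equiv.swap_apply_of_ne_of_ne hac.symm hbc.symm
  have hbca : swap b c a = a := Equiv.swap_apply_of_ne_of_ne hab hac
  simp only [← Matrix.mulVec_mulVec]
  rcases lt_or_gt_of_ne (w.injective.ne hab) with h₁ | h₁ <;>
  rcases lt_or_gt_of_ne (w.injective.ne hbc) with h₂ | h₂ <;>
  rcases lt_or_gt_of_ne (w.injective.ne hac) with h₃ | h₃ <;>
  first
  | exact absurd (h₁.trans h₂) h₃.not_gt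
  | exact absurd (h₂.trans h₁) h₃.not_gt
  | (simp only [heckeMatrix_mulVec_single, Matrix.mulVec_smul, Matrix.mulVec_add, h₁, h₂, h₃,
      h₁.not_gt, h₂.not_gt, h₃.not_gt, habc, hbca, hswap, hsq, Equiv.Perm.mul_apply,
      Equiv.swap_apply_left, Equiv.swap_apply_right, if_true, if_false] <;> module)

end HeckeMatrix

variable {K : Type*} [CommRing K] {n : ℕ}

/-- The matrices by which the generators of the Hecke algebra of type `A_n` act on the free module
on permutations, for `α * β = -(u₀ * u₁)` and `t = u₀ + u₁`. The parameters `α`, `β` rescale the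
basis: `α = 1` gives the regular representation, `α = β` a symmetric form of it. As `Fin.ofNat`
reduces modulo `n + 1`, only the matrices with `i < n` are meaningful. -/
def heckeModel (n : ℕ) (t α β : K) (i : ℕ) : Matrix (Perm (Fin (n + 1))) (Perm (Fin (n + 1))) K :=
  heckeMatrix t α β (Fin.ofNat (n + 1) i) (Fin.ofNat (n + 1) (i + 1))

theorem ofNat_ne_ofNat {i j : ℕ} (hij : i ≠ j) (hi : i ≤ n) (hj : j ≤ n) :
    Fin.ofNat (n + 1) i ≠ Fin.ofNat (n + 1) j := by
  simpa [Fin.ext_iff, Nat.mod_eq_of_lt (Nat.lt_succ_of_le hi),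
    Nat.mod_eq_of_lt (Nat.lt_succ_of_le hj)]

theorem isHeckeSystem_heckeModel {u₀ u₁ α β : K} (hαβ : α * β = -(u₀ * u₁)) :
    IsHeckeSystem u₀ u₁ (heckeModel n (u₀ + u₁) α β) n where
  braid i hi := heckeMatrix_braid _ _ _ (ofNat_ne_ofNat (by lia) (by lia) (by lia))
    (ofNat_ne_ofNat (by lia) (by lia) (by lia)) (ofNat_ne_ofNat (by lia) (by lia) (by lia))
  comm i j hij hj := by
    apply heckeMatrix_commute <;> apply ofNat_ne_ofNat <;> lia
  quadratic i hi := by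
    rw [sub_algebraMap_mul_sub_algebraMap_eq_zero_iff, heckeModel,
      heckeMatrix_mul_self _ _ _ (ofNat_ne_ofNat (by lia) (by lia) (by lia)), hαβ, neg_smul,
      sub_eq_add_neg]

theorem heckeModel_map {L : Type*} [CommRing L] (φ : K →+* L) (n : ℕ) (t α β : K) (i : ℕ) :
    φ.mapMatrix (heckeModel n t α β i) = heckeModel n (φ t) (φ α) (φ β) i :=
  heckeMatrix_map φ t α β _ _

theorem eq_top_of_heckeModel_stable {t β : K} {α : Kˣ}
    {N : Submodule K (Perm (Fin (n + 1)) → K)} (hone : Pi.single 1 1 ∈ N)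
    (hN : ∀ i < n, ∀ v ∈ N, (heckeModel n t α β i).mulVec v ∈ N) : N = ⊤ := by
  have hsingle : ∀ w, Pi.single w 1 ∈ N := by
    refine perm_induction_of_ascent hone fun w i hi hw => ?_
    have hmem := hN i i.isLt _ hw
    have hcast : Fin.ofNat (n + 1) i = i.castSucc := by ext; simp
    have hsucc : Fin.ofNat (n + 1) (i + 1) = i.succ := by ext; simp
    rw [heckeModel, hcast, hsucc, heckeMatrix_mulVec_single, if_pos hi] at hmem
    exact (N.smul_mem_iff_of_isUnit α.isUnit).1 hmem
  rw [eq_top_iff, ← (Pi.basisFun K _).span_eq, Submodule.span_le]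
  rintro _ ⟨w, rfl⟩
  simpa using hsingle w

namespace IsHeckeSystem

variable {A : Type*} [Ring A] [Algebra K A] {u₀ u₁ β : K} {α : Kˣ} {s : ℕ → A}

theorem eq_zero_of_snd_eq_zero (h : IsHeckeSystem u₀ u₁ s n) (hαβ : α * β = -(u₀ * u₁))
    {x : A × Matrix (Perm (Fin (n + 1))) (Perm (Fin (n + 1))) K}
    (hx : x ∈ Algebra.adjoin K ((fun i => (s i, heckeModel n (u₀ + u₁) α β i)) '' Set.Iio n))
    (hx₂ : x.2 = 0) : x = 0 := by
  set t := fun i => (s i, heckeModel n (u₀ + u₁) α β i)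
  set S := Algebra.adjoin K (t '' Set.Iio n)
  let f : A × Matrix (Perm (Fin (n + 1))) (Perm (Fin (n + 1))) K →ₗ[K] Perm (Fin (n + 1)) → K :=
    Matrix.mulVecBilin K K |>.flip (Pi.single 1 1) |>.comp (LinearMap.snd K _ _)
  have hf : ∀ x, f x = x.2.mulVec (Pi.single 1 1) := fun _ => rfl
  obtain ⟨B, hB, hSB⟩ :=
    (h.prod (isHeckeSystem_heckeModel hαβ)).exists_card_le_factorial_adjoin_le_span le_rfl
  have htop : S.toSubmodule.map f = ⊤ := by
    refine eq_top_of_heckeModel_stable (t := u₀ + u₁) (α := α) (β := β)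
      ⟨1, S.one_mem, Matrix.one_mulVec _⟩ ?_
    rintro i hi _ ⟨x, hx, rfl⟩
    exact ⟨t i * x, S.mul_mem (Algebra.subset_adjoin ⟨i, hi, rfl⟩) hx,
      (Matrix.mulVec_mulVec _ _ _).symm⟩
  have hinj := injOn_span_of_card_le (by simpa [Fintype.card_perm] using hB) f
    (top_le_iff.1 (htop ▸ Submodule.map_mono hSB))
  exact hinj (hSB hx) (zero_mem _) (by simp [hf, hx₂])

theorem aeval_fundamental_eq_zero_of_heckeModel (h : IsHeckeSystem u₀ u₁ s n)
    (hαβ : α * β = -(u₀ * u₁)) {p : K[X]}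
    (hp : aeval (fundamental (heckeModel n (u₀ + u₁) α β) n) p = 0) :
    aeval (fundamental s n) p = 0 := by
  let t := fun i => (s i, heckeModel n (u₀ + u₁) α β i)
  have hpair : aeval (fundamental t n) p = (aeval (fundamental s n) p, 0) := by
    rw [fundamental_prodMk, aeval_prod_apply, hp]
  have hmem : aeval (fundamental t n) p ∈ Algebra.adjoin K (t '' Set.Iio n) :=
    Algebra.adjoin_le (Set.singleton_subset_iff.2 (fundamental_mem
      (S := (Algebra.adjoin K (t '' Set.Iio n)).toSubmonoid)
      fun i hi => Algebra.subset_adjoin ⟨i, hi, rfl⟩)) (aeval_mem_adjoin_singleton K _)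
  rw [hpair] at hmem
  exact congrArg Prod.fst (h.eq_zero_of_snd_eq_zero hαβ hmem rfl)

end IsHeckeSystem

end Model

section Specialization

open Equiv (Perm)
open Polynomial

theorem aeval_fundamental_heckeModel_eq_zero_of_sq {n : ℕ} {u₀ u₁ α : ℝ} (h₀ : u₀ ≠ 0)
    (h₁ : u₁ ≠ 0) (hα : α * α = -(u₀ * u₁)) :
    aeval (fundamental (heckeModel n (u₀ + u₁) α α) n) (garsidePoly n u₀ u₁) = 0 := by
  let Φ := Matrix.toLpLinAlgEquiv (R := ℝ) (n := Perm (Fin (n + 1))) 2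
  have hs : IsHeckeSystem u₀ u₁ (fun i => Φ (heckeModel n (u₀ + u₁) α α i)) n :=
    (isHeckeSystem_heckeModel hα).map Φ.toAlgHom
  have hsymm : ∀ i < n, (Φ (heckeModel n (u₀ + u₁) α α i)).IsSymmetric := fun i _ =>
    Matrix.isSymmetric_toEuclideanLin_iff.2
      ((Matrix.conjTranspose_eq_transpose_of_trivial _).trans (heckeMatrix_isSymm _ _ _ _))
  apply Φ.injective
  rw [map_zero, ← aeval_algHom_apply, map_fundamental]
  exact hs.aeval_fundamental_eq_zero_of_isSymmetric h₀ h₁ hsymm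

/-- The matrix by which `garsidePoly n u₀ u₁`, evaluated at the fundamental element, acts in the
regular representation on permutations. -/
noncomputable def garsideMatrix {K : Type*} [CommRing K] (n : ℕ) (u₀ u₁ : K) :
    Matrix (Perm (Fin (n + 1))) (Perm (Fin (n + 1))) K :=
  aeval (fundamental (heckeModel n (u₀ + u₁) 1 (-(u₀ * u₁))) n) (garsidePoly n u₀ u₁)

theorem garsideMatrix_map {K L : Type*} [CommRing K] [CommRing L] (φ : K →+* L) (n : ℕ)
    (u₀ u₁ : K) : φ.mapMatrix (garsideMatrix n u₀ u₁) = garsideMatrix n (φ u₀) (φ u₁) := by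
  have hcomp : φ.mapMatrix.comp (algebraMap K (Matrix (Perm (Fin (n + 1)))
      (Perm (Fin (n + 1))) K)) = (algebraMap L _).comp φ := by
    ext x i j
    by_cases hij : i = j <;> simp [Matrix.algebraMap_matrix_apply, hij]
  rw [garsideMatrix, aeval_def, hom_eval₂, hcomp, ← eval₂_map, garsidePoly_map, map_fundamental,
    garsideMatrix, aeval_def]
  simp only [heckeModel_map, map_add, map_one, map_neg, map_mul]

theorem garsideMatrix_eq_zero_of_mul_neg {n : ℕ} {u₀ u₁ : ℝ} (h : u₀ * u₁ < 0) :
    garsideMatrix n u₀ u₁ = 0 := by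
  have hpos : 0 < -(u₀ * u₁) := neg_pos.2 h
  have hα : √(-(u₀ * u₁)) * √(-(u₀ * u₁)) = -(u₀ * u₁) := Real.mul_self_sqrt hpos.le
  exact (isHeckeSystem_heckeModel (one_mul _)).aeval_fundamental_eq_zero_of_heckeModel
    (α := Units.mk0 _ (Real.sqrt_pos.2 hpos).ne') hα
    (aeval_fundamental_heckeModel_eq_zero_of_sq (left_ne_zero_of_mul h.ne)
      (right_ne_zero_of_mul h.ne) hα)

theorem garsideMatrix_generic_eq_zero (n : ℕ) : garsideMatrix n
    (MvPolynomial.X 0 : MvPolynomial (Fin 2) ℤ) (MvPolynomial.X 1) = 0 := by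
  ext1 v w
  refine MvPolynomial.map_injective (Int.castRingHom ℝ) Int.cast_injective ?_
  have hinf : ∀ i, (![Set.Ioi 0, Set.Iio 0] i : Set ℝ).Infinite :=
    Fin.forall_fin_two.2 ⟨Set.Ioi_infinite 0, Set.Iio_infinite 0⟩
  refine MvPolynomial.funext_set _ hinf fun x hx => ?_
  have hneg : x 0 * x 1 < 0 := mul_neg_of_pos_of_neg (hx 0 trivial) (hx 1 trivial)
  have hmap := garsideMatrix_map
    ((MvPolynomial.eval x).comp (MvPolynomial.map (Int.castRingHom ℝ))) n
    (MvPolynomial.X 0) (MvPolynomial.X 1)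
  simp only [RingHom.comp_apply, MvPolynomial.map_X, MvPolynomial.eval_X,
    garsideMatrix_eq_zero_of_mul_neg hneg] at hmap
  simpa using congrFun₂ hmap v w

theorem garsideMatrix_eq_zero {K : Type*} [CommRing K] (n : ℕ) (u₀ u₁ : K) :
    garsideMatrix n u₀ u₁ = 0 := by
  simpa [garsideMatrix_generic_eq_zero] using (garsideMatrix_map
    (MvPolynomial.aeval (R := ℤ) ![u₀, u₁]).toRingHom n (MvPolynomial.X 0) (MvPolynomial.X 1)).symm

end Specialization

section Hecke

/-- The Artin generators, extended by `1` to a sequence indexed by `ℕ`. -/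
def braidGen (n i : ℕ) : BraidGroup n := if h : i < n then artinGen ⟨i, h⟩ else 1

theorem isBraidSystem_braidGen (n : ℕ) : IsBraidSystem (braidGen n) n where
  braid i hi := by
    simp only [braidGen, hi, i.lt_succ_self.trans hi, dif_pos]
    exact PresentedGroup.mk_eq_mk_of_mul_inv_mem (.inl ⟨_, _, rfl, rfl⟩)
  comm i j hij hj := by
    simp only [braidGen, hj, show i < n by lia, dif_pos]
    exact PresentedGroup.mk_eq_mk_of_mul_inv_mem (.inr ⟨⟨i, by lia⟩, ⟨j, hj⟩, hij, rfl⟩)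

theorem initialProduct_eq_ascProd {n : ℕ} (t : Fin n) :
    initialProduct t = ascProd (braidGen n) (t + 1) := by
  rw [ascProd_eq_prod_ofFn, initialProduct]
  congr 2
  funext i
  rw [braidGen, dif_pos (by lia)]
  rfl

theorem garside_eq_fundamental (n : ℕ) : garside n = fundamental (braidGen n) n := by
  rw [fundamental_eq_prod_ofFn, garside]
  congr 2
  funext i
  rw [initialProduct_eq_ascProd, Fin.val_rev]
  congr 1
  lia

variable {K : Type*} [CommRing K] {n : ℕ} (u₀ u₁ : Kˣ)

/-- `toHecke` as a monoid homomorphism. -/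
noncomputable def toHeckeHom : BraidGroup n →* HeckeAlgebra n u₀ u₁ :=
  (RingQuot.mkAlgHom K (HeckeRel n u₀ u₁) : _ →* _).comp (MonoidAlgebra.of K (BraidGroup n))

theorem toHecke_garside :
    toHecke u₀ u₁ (garside n) = fundamental (fun i => toHeckeHom u₀ u₁ (braidGen n i)) n := by
  rw [← map_fundamental, ← garside_eq_fundamental]
  rfl

theorem isHeckeSystem_toHeckeHom_braidGen :
    IsHeckeSystem (u₀ : K) (u₁ : K) (fun i => toHeckeHom u₀ u₁ (braidGen n i)) n where
  toIsBraidSystem := (isBraidSystem_braidGen n).map (toHeckeHom u₀ u₁)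
  quadratic i hi := by
    have hrefl : IsBraidedReflection (braidGen n i) := by
      rw [braidGen, dif_pos hi]
      exact ⟨_, IsConj.refl _⟩
    have hrel := RingQuot.mkAlgHom_rel K (HeckeRel.quadratic (u₀ := u₀) (u₁ := u₁) _ hrefl)
    rw [map_mul, map_sub, map_sub, AlgHom.commutes, AlgHom.commutes, map_zero] at hrel
    exact hrel

end Hecke

end TypeA

theorem lemma2p11_general {K A : Type*} [CommRing K] [Ring A] [Algebra K A] {n : ℕ} {u₀ u₁ : K}
    {s : ℕ → A} (h : TypeA.IsHeckeSystem u₀ u₁ s n) :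
    Polynomial.aeval (TypeA.fundamental s n) (TypeA.garsidePoly n u₀ u₁) = 0 :=
  h.aeval_fundamental_eq_zero_of_heckeModel (α := 1) (one_mul _)
    (TypeA.garsideMatrix_eq_zero n u₀ u₁)

theorem lemma2p11 {K : Type*} [CommRing K] (n : ℕ) (u₀ u₁ : Kˣ) :
    Polynomial.aeval (TypeA.toHecke u₀ u₁ (TypeA.garside n))
      (∏ p ∈ Finset.HasAntidiagonal.antidiagonal (n * (n + 1)),
        (Polynomial.X ^ 2 -
          Polynomial.C ((-1 : K) ^ p.1 * (u₀ : K) ^ p.1 * (u₁ : K) ^ p.2))) = 0 := by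
  rw [TypeA.toHecke_garside]
  exact lemma2p11_general (TypeA.isHeckeSystem_toHeckeHom_braidGen u₀ u₁)
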